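/- All graphs are finite. Let $G$ denote a simple graph without loops and $H$ a simple graph in which loops are allowed. An $H$-colouring of $G$ is a map $\psi:V(G)\to V(H)$ such that $\psi(i)\psi(j)\in E(H)$ whenever $ij\in E(G)$, and $\hom(G,H)$ is the number of $H$-colourings of $G$. A complete looped graph is a graph in which every two (equal or distinct) vertices are adjacent, and a complete balanced bipartite graph is a graph isomorphic to $K_{k,k}$ for some $k\ge 1$. For every $\delta\geq 3$ and every (not necessarily connected) graph $H$, there exists a constant $\kappa(\delta,H)$ such that the following holds: if $n\geq\kappa(\delta,H)$ and $G$ is a connected graph on $n$ vertices with minimum degree at least $\delta$, then $$\hom(G,H)\leq\hom(K_{\delta,n-\delta},H).$$ Further, if $H$ has a component which contains at least one edge (a loop counts as an edge) and which is neither a complete looped graph nor a complete balanced bipartite graph, then equality holds if and only if $G$ is isomorphic to $K_{\delta,n-\delta}$. -/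

import Mathlib

/-- A simple graph on the vertex type `V` in which loops are allowed: any symmetric relation. -/
@[ext]
structure LoopGraph (V : Type*) where
  Adj : V → V → Prop
  symm : ∀ u v, Adj u v → Adj v u

namespace LoopGraph

variable {V : Type*}

/-- The subgraph induced by a set of vertices. -/
def induce (H : LoopGraph V) (C : Set V) : LoopGraph C where
  Adj u v := H.Adj u v
  symm u v h := H.symm u v h

/-- `C` is the vertex set of a connected component of `H`: all vertices that can be reached by a
walk from some vertex `v`. -/
def IsComponent (H : LoopGraph V) (C : Set V) : Prop :=
  ∃ v, C = {w | Relation.ReflTransGen H.Adj v w}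

/-- There is at least one edge; a loop counts as an edge. -/
def HasEdge (H : LoopGraph V) : Prop :=
  ∃ u v, H.Adj u v

/-- Complete looped graph: every two vertices, equal or distinct, are adjacent. -/
def IsCompleteLooped (H : LoopGraph V) : Prop :=
  ∀ u v, H.Adj u v

/-- Complete balanced bipartite graph: isomorphic to `K_{k,k}` for some `k`. -/
def IsCompleteBalancedBipartite (H : LoopGraph V) : Prop :=
  ∃ k : ℕ, Nonempty ((completeBipartiteGraph (Fin k) (Fin k)).Adj ≃r H.Adj)

end LoopGraph

/-- The number of `H`-colourings of `G`, i.e. of maps `V(G) → V(H)` that send edges of `G` to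
edges of `H`. -/
noncomputable def homCount {W V : Type*} (G : SimpleGraph W) (H : LoopGraph V) : ℕ :=
  Nat.card (G.Adj →r H.Adj)

/-!
Fix a connected target `H` with an edge, let `k` be its largest neighbourhood size, and build up a
colouring of `G` along a growing set of vertices. A *single step* adds a vertex adjacent to the
current set and leaves at most `k` choices. A *pair step* adds both ends of an edge, each end being
adjacent to the current set, and leaves at most `k ^ 2` choices; if `H` is neither complete looped
nor complete balanced bipartite, then at most `k ^ 2 - 1` (`LoopGraph.card_links_lt`). So each pair
step gains a constant factor over the trivial bound (`Grows.card_extensions_le`).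

On the other side, let `s` be the number of `δ`-tuples in `H` with `k` common neighbours. Colouring
the small class of `K_{δ,n-δ}` by such a tuple gives at least `s * k ^ (n - δ)` colourings
(`card_richTuples_mul_le`). Hence `G` has fewer colourings than `K_{δ,n-δ}` as soon as a large
constant number of pair steps is possible.

If `G` has minimum degree at least three and some edge is disjoint from the current set, then
breadth-first search finds a pair step after `O(log n)` single steps, because otherwise the layers
of the search would double in size too often (`exists_layer`, `exists_short_pair`). Therefore either
there are many pair steps or a set `A` of size `O(log n)` meets all edges (`grows_or_cover`). In the
second case all vertices outside `A` have at least `δ` neighbours, all in `A`, so by pigeonhole some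
`δ` vertices have many common neighbours (`exists_common_nbrs`). Colour these `δ` vertices first.
The tuples with fewer than `k` common neighbours contribute a negligible amount, and the other `s`
tuples extend in at most `k ^ (n - δ)` ways each. One more pair step makes this strictly smaller
than `s * k ^ (n - δ)` (`card_colourings_lt_of_common_nbrs`). If there is none, then the `δ` vertices
meet all edges, so `G` contains `K_{δ,n-δ}`, and any additional edge destroys some colouring
(`card_colourings_lt_or_iso_of_cover`).

For complete looped and complete balanced bipartite targets the bound is elementary, and for
arbitrary `H` the counts add up over its components (`homCount_eq_sum_components`).
-/

open Finset

/-! ### Growing vertex sets in graphs of minimum degree three -/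

/-- `Attach G A B`: the set `B` arises from `A` by adding vertices one at a time, each adjacent to
a vertex already present. -/
inductive Attach {W : Type*} [DecidableEq W] (G : SimpleGraph W) (A : Finset W) : Finset W → Prop
  | refl : Attach G A A
  | step {B : Finset W} {a v : W} : Attach G A B → v ∉ B → a ∈ B → G.Adj a v →
      Attach G A (insert v B)

/-- `Grows G A f g B`: the set `B` arises from `A` by `f` single steps, which add a vertex adjacent
to the current set, and `g` pair steps, which add the two ends of an edge disjoint from the current
set, each end being adjacent to the current set. -/
inductive Grows {W : Type*} [DecidableEq W] (G : SimpleGraph W) (A : Finset W) :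
    ℕ → ℕ → Finset W → Prop
  | refl : Grows G A 0 0 A
  | single {f g : ℕ} {B : Finset W} {a v : W} : Grows G A f g B → v ∉ B → a ∈ B → G.Adj a v →
      Grows G A (f + 1) g (insert v B)
  | pair {f g : ℕ} {B : Finset W} {a b x y : W} : Grows G A f g B → x ∉ B → y ∉ B → a ∈ B → b ∈ B →
      G.Adj x y → G.Adj a x → G.Adj b y → Grows G A f (g + 1) (insert x (insert y B))

section Growth

variable {W : Type*} [DecidableEq W] {G : SimpleGraph W} {A B C : Finset W}

lemma Attach.subset (h : Attach G A B) : A ⊆ B := by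
  induction h with
  | refl => exact Subset.rfl
  | step _ _ _ _ ih => exact ih.trans (subset_insert _ _)

lemma Attach.union (hB : Attach G A B) (hC : Attach G A C) : Attach G A (B ∪ C) := by
  induction hC with
  | refl => rwa [union_eq_left.2 hB.subset]
  | @step D a v _ _ ha hav ih =>
    rw [union_insert]
    by_cases hv : v ∈ B ∪ D
    · rwa [insert_eq_of_mem hv]
    · exact ih.step hv (mem_union_right _ ha) hav

lemma Attach.card_union_add (hB : Attach G A B) (hC : Attach G A C) :
    #(B ∪ C) + #A ≤ #B + #C := by
  rw [← card_union_add_card_inter B C]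
  exact Nat.add_le_add_left (card_le_card (subset_inter hB.subset hC.subset)) _

lemma Attach.grows (h : Attach G A B) : ∃ f, Grows G A f 0 B := by
  induction h with
  | refl => exact ⟨0, .refl⟩
  | step _ hv ha hav ih => obtain ⟨f, hf⟩ := ih; exact ⟨f + 1, hf.single hv ha hav⟩

lemma Grows.card {f g : ℕ} (h : Grows G A f g B) : #B = #A + f + 2 * g := by
  induction h with
  | refl => rfl
  | single _ hv _ _ ih => rw [card_insert_of_notMem hv, ih]; ring
  | pair _ hx hy _ _ hxy _ _ ih =>
    rw [card_insert_of_notMem (by simp [hx, hxy.ne]), card_insert_of_notMem hy, ih]; ring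

lemma Grows.subset {f g : ℕ} (h : Grows G A f g B) : A ⊆ B := by
  induction h with
  | refl => exact Subset.rfl
  | single _ _ _ _ ih => exact ih.trans (subset_insert _ _)
  | pair _ _ _ _ _ _ _ _ ih => exact ih.trans ((subset_insert _ _).trans (subset_insert _ _))

lemma Grows.trans {f g f' g' : ℕ} (h : Grows G A f g B) (h' : Grows G B f' g' C) :
    Grows G A (f + f') (g + g') C := by
  induction h' with
  | refl => exact h
  | single _ hv ha hav ih => exact ih.single hv ha hav
  | pair _ hx hy ha hb hxy hax hby ih => exact ih.pair hx hy ha hb hxy hax hby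

/-- Any cycle that closes up during single steps contains a pair step: the later of the two
neighbours `p`, `q` of `v` can be postponed and added together with `v`. -/
lemma Attach.exists_pair (h : Attach G A B) {v p q : W} (hv : v ∉ B) (hp : p ∈ B) (hq : q ∈ B)
    (hpA : p ∉ A) (hpq : p ≠ q) (hpv : G.Adj p v) (hqv : G.Adj q v) :
    ∃ f C, Grows G A f 1 C ∧ C ⊆ insert v B := by
  induction h with
  | refl => exact absurd hp hpA
  | @step D a u hD hu ha hau ih =>
    have hvD : v ∉ D := fun h => hv (mem_insert_of_mem h)
    obtain ⟨f, hf⟩ := hD.grows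
    rcases mem_insert.1 hp with rfl | hp'
    · rcases mem_insert.1 hq with rfl | hq'
      · exact absurd rfl hpq
      · exact ⟨f, _, hf.pair hvD hu hq' ha hpv.symm hqv hau, Subset.rfl⟩
    · rcases mem_insert.1 hq with rfl | hq'
      · exact ⟨f, _, hf.pair hvD hu hp' ha hqv.symm hpv hau, Subset.rfl⟩
      · obtain ⟨f', C, hC, hCs⟩ := ih hvD hp' hq'
        exact ⟨f', C, hC, hCs.trans (insert_subset_insert _ (subset_insert _ _))⟩

variable [Fintype W]

/-- Every nonempty set grows to the whole vertex set of a connected graph by single steps. -/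
lemma exists_grows_univ (hG : G.Connected) (hA : A.Nonempty) : ∃ f, Grows G A f 0 univ := by
  suffices h : ∀ r (B : Finset W), Attach G A B → #Bᶜ = r → Attach G A univ from
    (h _ A .refl rfl).grows
  intro r
  induction r with
  | zero =>
    intro B hB h
    rw [card_eq_zero, compl_eq_empty_iff] at h
    rwa [h] at hB
  | succ r ih =>
    intro B hB h
    obtain ⟨w, hw⟩ : (Bᶜ).Nonempty := card_pos.1 (by omega)
    obtain ⟨b, hb⟩ := hA.mono hB.subset
    obtain ⟨p⟩ := hG.preconnected b w
    obtain ⟨d, -, hd1, hd2⟩ := p.exists_boundary_dart (B : Set W) hb (by simpa using hw)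
    have hd2' : d.snd ∉ B := hd2
    refine ih _ (hB.step hd2' hd1 d.adj) ?_
    rw [compl_insert, card_erase_of_mem (mem_compl.2 hd2'), h]; rfl

/-- Breadth-first search from `x`: as long as no short pair step exists, the layers at least double
in size. Here `L` is a layer and `S` the union of the layers before it. -/
lemma exists_layer [DecidableRel G.Adj] (hdeg : ∀ v, 3 ≤ G.degree v) {a x z : W}
    (ha : a ∈ A) (hx : x ∉ A) (hax : G.Adj a x) (hz : z ∉ A) (hxz : G.Adj x z) (d : ℕ)
    (hno : ∀ f C, Grows G A f 1 C → #A + 2 * d + 3 < #C) (j : ℕ) (hj : j ≤ d) :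
    ∃ S L : Finset W, Disjoint S A ∧ Disjoint L A ∧ Disjoint L S ∧ 2 ^ j ≤ #L ∧
      (∀ q ∈ S, ∃ B, Attach G A B ∧ q ∈ B ∧ B ⊆ A ∪ S ∧ #B ≤ #A + j + 1) ∧
      ∀ u ∈ L, ∃ q ∈ S, G.Adj q u := by
  induction j with
  | zero =>
    refine ⟨{x}, {z}, ?_, ?_, ?_, ?_, ?_, ?_⟩
    · simpa using hx
    · simpa using hz
    · simpa using hxz.ne'
    · simp
    · intro q hq
      rw [mem_singleton] at hq
      subst hq
      refine ⟨insert q A, Attach.refl.step hx ha hax, mem_insert_self _ _, ?_, ?_⟩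
      · rw [union_comm]; rfl
      · rw [card_insert_of_notMem hx]
    · simpa using hxz
  | succ j ih =>
    obtain ⟨S, L, hSA, hLA, hLS, hcard, hS, hL⟩ := ih (by omega)
    -- each vertex of the layer is reached from `A` through earlier layers only
    have key : ∀ u ∈ L, ∃ B, Attach G A B ∧ u ∈ B ∧ B ⊆ A ∪ S ∪ {u} ∧ #B ≤ #A + j + 2 := by
      intro u hu
      obtain ⟨q, hq, hqu⟩ := hL u hu
      obtain ⟨B, hB, hqB, hBs, hBc⟩ := hS q hq
      have huB : u ∉ B := fun h => by
        rcases mem_union.1 (hBs h) with h | h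
        · exact disjoint_left.1 hLA hu h
        · exact disjoint_left.1 hLS hu h
      refine ⟨insert u B, hB.step huB hqB hqu, mem_insert_self _ _, ?_, ?_⟩
      · rw [insert_eq, union_comm]; exact union_subset_union_left hBs
      · rw [card_insert_of_notMem huB]; omega
    -- two short connections that meet in a common neighbour `v` would give a short pair step
    have nopair : ∀ B B' v p q, Attach G A B → Attach G A B' → v ∉ B → v ∉ B' → p ∈ B → q ∈ B' →
        p ∉ A → p ≠ q → G.Adj p v → G.Adj q v → #B + #B' + 1 ≤ 2 * #A + 2 * j + 5 → False := by
      intro B B' v p q hB hB' hvB hvB' hp hq hpA hpq hpv hqv hc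
      obtain ⟨f, C, hC, hCs⟩ := (hB.union hB').exists_pair (v := v) (by simp [hvB, hvB'])
        (mem_union_left _ hp) (mem_union_right _ hq) hpA hpq hpv hqv
      have h1 := hno f C hC
      have h2 := card_le_card hCs
      have h3 := card_insert_le v (B ∪ B')
      have h4 := hB.card_union_add hB'
      omega
    refine ⟨S ∪ L, (L.biUnion fun u => G.neighborFinset u) \ (A ∪ S ∪ L), ?_, ?_, ?_, ?_, ?_, ?_⟩
    · exact disjoint_union_left.2 ⟨hSA, hLA⟩
    · rw [disjoint_left]; intro w hw; simp only [mem_sdiff, mem_union] at hw; tauto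
    · rw [disjoint_left]; intro w hw; simp only [mem_sdiff, mem_union] at hw ⊢; tauto
    · set L' := (L.biUnion fun u => G.neighborFinset u) \ (A ∪ S ∪ L) with hL'
      have hdc : #L * 2 ≤ #L' * 1 := by
        refine card_mul_le_card_mul (fun u w => G.Adj u w) ?_ ?_
        · intro u hu
          obtain ⟨q, hq, hqu⟩ := hL u hu
          have hqA : q ∉ A := disjoint_left.1 hSA hq
          obtain ⟨B, hB, hqB, hBs, hBc⟩ := hS q hq
          have notin : ∀ B' ⊆ A ∪ S, u ∉ B' := fun B' hB' h => by
            rcases mem_union.1 (hB' h) with h | h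
            · exact disjoint_left.1 hLA hu h
            · exact disjoint_left.1 hLS hu h
          have hsub : (G.neighborFinset u).erase q ⊆ bipartiteAbove (fun u w => G.Adj u w) L' u := by
            intro p hp
            rw [mem_erase, SimpleGraph.mem_neighborFinset] at hp
            obtain ⟨hpq, hup⟩ := hp
            rw [mem_bipartiteAbove]
            refine ⟨?_, hup⟩
            rw [hL', mem_sdiff]
            refine ⟨mem_biUnion.2 ⟨u, hu, by simpa using hup⟩, ?_⟩
            intro hmem
            rw [mem_union, mem_union] at hmem
            rcases hmem with (hpA | hpS) | hpL
            · exact nopair B A u q p hB .refl (notin B hBs) (disjoint_left.1 hLA hu) hqB hpA hqA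
                hpq.symm hqu hup.symm (by omega)
            · obtain ⟨B', hB', hpB', hBs', hBc'⟩ := hS p hpS
              exact nopair B B' u q p hB hB' (notin B hBs) (notin B' hBs') hqB hpB' hqA
                hpq.symm hqu hup.symm (by omega)
            · obtain ⟨B', hB', hpB', hBs', hBc'⟩ := key p hpL
              have huB' : u ∉ B' := fun h => by
                rcases mem_union.1 (hBs' h) with h | h
                · exact notin _ Subset.rfl h
                · exact hup.ne (mem_singleton.1 h)
              exact nopair B B' u q p hB hB' (notin B hBs) huB' hqB hpB' hqA
                hpq.symm hqu hup.symm (by omega)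
          have h1 := card_le_card hsub
          have h2 : #((G.neighborFinset u).erase q) = G.degree u - 1 := by
            rw [card_erase_of_mem (by simpa using hqu.symm)]; rfl
          have h3 := hdeg u
          omega
        · intro w hw
          rw [card_le_one]
          intro u hu u' hu'
          rw [mem_bipartiteBelow] at hu hu'
          by_contra hne
          obtain ⟨B, hB, huB, hBs, hBc⟩ := key u hu.1
          obtain ⟨B', hB', huB', hBs', hBc'⟩ := key u' hu'.1
          rw [hL', mem_sdiff, mem_union, mem_union] at hw
          have hwB : ∀ u ∈ L, ∀ B ⊆ A ∪ S ∪ {u}, w ∉ B := fun u hu B hB h => by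
            have := hB h
            rw [mem_union, mem_union, mem_singleton] at this
            rcases this with h | rfl
            · exact hw.2 (Or.inl h)
            · exact hw.2 (Or.inr hu)
          exact nopair B B' w u u' hB hB' (hwB u hu.1 B hBs) (hwB u' hu'.1 B' hBs') huB huB'
            (disjoint_left.1 hLA hu.1) hne hu.2 hu'.2 (by omega)
      rw [pow_succ]; omega
    · intro q hq
      rcases mem_union.1 hq with hq | hq
      · obtain ⟨B, hB, hqB, hBs, hBc⟩ := hS q hq
        exact ⟨B, hB, hqB, hBs.trans (union_subset_union_right subset_union_left), by omega⟩
      · obtain ⟨B, hB, hqB, hBs, hBc⟩ := key q hq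
        refine ⟨B, hB, hqB, hBs.trans ?_, by omega⟩
        rw [union_assoc]
        exact union_subset_union_right (union_subset_union_right (singleton_subset_iff.2 hq))
    · intro w hw
      rw [mem_sdiff, mem_biUnion] at hw
      obtain ⟨⟨u, hu, huw⟩, -⟩ := hw
      exact ⟨u, mem_union_right _ hu, by simpa using huw⟩

/-- In a connected graph of minimum degree at least three, a pair step is available after few
single steps as long as some edge is disjoint from the current set. -/
lemma exists_short_pair [DecidableRel G.Adj] (hG : G.Connected) (hdeg : ∀ v, 3 ≤ G.degree v)
    (hA : A.Nonempty) {y z : W} (hy : y ∉ A) (hz : z ∉ A) (hyz : G.Adj y z) {d : ℕ}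
    (hd : Fintype.card W < 2 ^ d) :
    ∃ f C, Grows G A f 1 C ∧ #C ≤ #A + 2 * d + 3 := by
  obtain ⟨a, x, z, ha, hx, hax, hz, hxz⟩ :
      ∃ a x z, a ∈ A ∧ x ∉ A ∧ G.Adj a x ∧ z ∉ A ∧ G.Adj x z := by
    -- a walk from `y` to `A` can leave the set of vertices outside `A` that have a neighbour
    -- outside `A` only by entering `A`
    obtain ⟨a, ha⟩ := hA
    obtain ⟨p⟩ := hG.preconnected y a
    obtain ⟨e, -, ⟨h1, t, ht, h1t⟩, h2⟩ := p.exists_boundary_dart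
      {v | v ∉ A ∧ ∃ t, t ∉ A ∧ G.Adj v t} ⟨hy, z, hz, hyz⟩ (fun h => h.1 ha)
    refine ⟨e.snd, e.fst, t, ?_, h1, e.adj.symm, ht, h1t⟩
    by_contra h
    exact h2 ⟨h, e.fst, h1, e.adj.symm⟩
  by_contra! hno
  obtain ⟨S, L, -, -, -, hL, -, -⟩ := exists_layer hdeg ha hx hax hz hxz d hno d le_rfl
  exact absurd (hL.trans (card_le_univ L)) (by omega)

/-- Either many pair steps are possible, or a small set meets all edges. -/
lemma grows_or_cover [DecidableRel G.Adj] (hG : G.Connected) (hdeg : ∀ v, 3 ≤ G.degree v)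
    (w : W) {d : ℕ} (hd : Fintype.card W < 2 ^ d) (g : ℕ) :
    (∃ f, Grows G {w} f g univ) ∨
      ∃ A : Finset W, #A ≤ 1 + g * (2 * d + 3) ∧ ∀ y z, G.Adj y z → y ∈ A ∨ z ∈ A := by
  suffices h : (∃ f A, Grows G {w} f g A ∧ #A ≤ 1 + g * (2 * d + 3)) ∨
      ∃ A : Finset W, #A ≤ 1 + g * (2 * d + 3) ∧ ∀ y z, G.Adj y z → y ∈ A ∨ z ∈ A by
    refine h.imp_left ?_
    rintro ⟨f, A, hA, -⟩
    obtain ⟨f', hf'⟩ := exists_grows_univ hG ((singleton_nonempty w).mono hA.subset)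
    exact ⟨f + f', hA.trans hf'⟩
  induction g with
  | zero => exact Or.inl ⟨0, {w}, .refl, by simp⟩
  | succ g ih =>
    rcases ih with ⟨f, A, hA, hc⟩ | ⟨A, hc, hcov⟩
    · by_cases hcov : ∀ y z, G.Adj y z → y ∈ A ∨ z ∈ A
      · exact Or.inr ⟨A, by rw [add_one_mul]; omega, hcov⟩
      · push Not at hcov
        obtain ⟨y, z, hyz, hy, hz⟩ := hcov
        obtain ⟨f', C, hC, hCc⟩ := exists_short_pair hG hdeg
          ((singleton_nonempty w).mono hA.subset) hy hz hyz hd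
        exact Or.inl ⟨f + f', C, hA.trans hC, by rw [add_one_mul]; omega⟩
    · exact Or.inr ⟨A, by rw [add_one_mul]; omega, hcov⟩

end Growth

/-! ### Counting colourings along a growing set -/

section Counting

variable {W V : Type*} [Fintype W] [Fintype V]

open Classical in
/-- The `H`-colourings of `G`, as a finite set of functions. -/
noncomputable def colourings (G : SimpleGraph W) (H : LoopGraph V) : Finset (W → V) :=
  {f | ∀ u v, G.Adj u v → H.Adj (f u) (f v)}

open Classical in
/-- The `H`-colourings of `G` that agree with `f₀` on `A`. -/
noncomputable def extensions (G : SimpleGraph W) (H : LoopGraph V) (A : Finset W) (f₀ : W → V) :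
    Finset (W → V) :=
  {f ∈ colourings G H | ∀ a ∈ A, f a = f₀ a}

open Classical in
/-- The set of neighbours of `v` in `H`, containing `v` itself if there is a loop at `v`. -/
noncomputable def LoopGraph.nbrs (H : LoopGraph V) (v : V) : Finset V := {w | H.Adj v w}

open Classical in
/-- The edges of `H`, as ordered pairs, from a neighbour of `i` to a neighbour of `j`. -/
noncomputable def LoopGraph.links (H : LoopGraph V) (i j : V) : Finset (V × V) :=
  {p ∈ H.nbrs i ×ˢ H.nbrs j | H.Adj p.1 p.2}

open Classical in
/-- The common neighbours of a family of vertices of `H`. -/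
noncomputable def LoopGraph.common (H : LoopGraph V) {ι : Type*} (g : ι → V) : Finset V :=
  {w | ∀ i, H.Adj (g i) w}

open Classical in
/-- The `δ`-tuples of vertices of `H` that have at least `k` common neighbours. -/
noncomputable def LoopGraph.richTuples (H : LoopGraph V) (k δ : ℕ) : Finset (Fin δ → V) :=
  {g | k ≤ #(H.common g)}

variable {G : SimpleGraph W} {H : LoopGraph V}

@[simp] lemma mem_colourings {f : W → V} :
    f ∈ colourings G H ↔ ∀ u v, G.Adj u v → H.Adj (f u) (f v) := by simp [colourings]

@[simp] lemma mem_extensions {A : Finset W} {f₀ f : W → V} :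
    f ∈ extensions G H A f₀ ↔ f ∈ colourings G H ∧ ∀ a ∈ A, f a = f₀ a := by simp [extensions]

@[simp] lemma LoopGraph.mem_nbrs {v w : V} : w ∈ H.nbrs v ↔ H.Adj v w := by simp [nbrs]

@[simp] lemma LoopGraph.mem_links {i j : V} {p : V × V} :
    p ∈ H.links i j ↔ (H.Adj i p.1 ∧ H.Adj j p.2) ∧ H.Adj p.1 p.2 := by simp [links]

@[simp] lemma LoopGraph.mem_common {ι : Type*} {g : ι → V} {w : V} :
    w ∈ H.common g ↔ ∀ i, H.Adj (g i) w := by simp [common]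

@[simp] lemma LoopGraph.mem_richTuples {k δ : ℕ} {g : Fin δ → V} :
    g ∈ H.richTuples k δ ↔ k ≤ #(H.common g) := by simp [richTuples]

lemma homCount_eq_card_colourings (G : SimpleGraph W) (H : LoopGraph V) :
    homCount G H = #(colourings G H) := by
  rw [homCount, ← Nat.card_eq_finsetCard]
  exact Nat.card_congr
    { toFun := fun f => ⟨f, mem_colourings.2 fun _ _ h => f.map_rel h⟩
      invFun := fun f => ⟨f.1, fun h => mem_colourings.1 f.2 _ _ h⟩
      left_inv := fun _ => rfl
      right_inv := fun _ => rfl }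

/-- If `φ` takes at most `#T` values on the extensions of `f₀`, and its value determines an
extension on `B`, then the extensions from `A` are at most `#T` times those from `B`. -/
lemma card_extensions_le_mul {α : Type*} [DecidableEq α] {A B : Finset W} {f₀ : W → V} {c : ℕ}
    (φ : (W → V) → α) (T : Finset α) (hT : ∀ f ∈ extensions G H A f₀, φ f ∈ T)
    (hφ : ∀ f f' : W → V, (∀ a ∈ A, f a = f' a) → φ f = φ f' → ∀ b ∈ B, f b = f' b)
    (hc : ∀ f, #(extensions G H B f) ≤ c) :
    #(extensions G H A f₀) ≤ #T * c := by
  rw [mul_comm]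
  refine card_le_mul_card_image_of_maps_to hT c fun t _ => ?_
  rcases ({f ∈ extensions G H A f₀ | φ f = t}).eq_empty_or_nonempty with h | ⟨f, hf⟩
  · rw [h]; exact Nat.zero_le _
  · refine le_trans (card_le_card fun f' hf' => ?_) (hc f)
    rw [mem_filter, mem_extensions] at hf hf'
    rw [mem_extensions]
    exact ⟨hf'.1.1, hφ _ _ (fun a ha => (hf'.1.2 a ha).trans (hf.1.2 a ha).symm)
      (hf'.2.trans hf.2.symm)⟩

lemma card_extensions_univ_le (f₀ : W → V) : #(extensions G H univ f₀) ≤ 1 := by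
  rw [card_le_one]
  intro f hf f' hf'
  rw [mem_extensions] at hf hf'
  ext w
  rw [hf.2 w (mem_univ _), hf'.2 w (mem_univ _)]

/-- A single step multiplies the number of partial colourings by at most `k`, a pair step by at
most `P`. -/
lemma Grows.card_extensions_le [DecidableEq W] {k P : ℕ} (hk : ∀ v, #(H.nbrs v) ≤ k)
    (hP : ∀ i j, #(H.links i j) ≤ P) {A B : Finset W} {f g c : ℕ} (h : Grows G A f g B)
    (hc : ∀ f₀, #(extensions G H B f₀) ≤ c) (f₀ : W → V) :
    #(extensions G H A f₀) ≤ k ^ f * P ^ g * c := by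
  classical
  induction h generalizing c f₀ with
  | refl => simpa using hc f₀
  | @single f g B a v _ hv ha hav ih =>
    have := ih (c := k * c) (fun f₁ => ?_) f₀
    · rw [pow_succ]; convert this using 1; ring
    · refine (card_extensions_le_mul (fun f => f v) (H.nbrs (f₁ a)) ?_ ?_ hc).trans
        (Nat.mul_le_mul_right _ (hk _))
      · intro f hf
        rw [mem_extensions, mem_colourings] at hf
        simpa [← hf.2 a ha] using hf.1 a v hav
      · intro f f' h h' b hb
        rcases mem_insert.1 hb with rfl | hb
        exacts [h', h b hb]
  | @pair f g B a b x y _ hx hy ha hb hxy hax hby ih =>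
    have := ih (c := P * c) (fun f₁ => ?_) f₀
    · rw [pow_succ]; convert this using 1; ring
    · refine (card_extensions_le_mul (fun f => (f x, f y)) (H.links (f₁ a) (f₁ b)) ?_ ?_ hc).trans
        (Nat.mul_le_mul_right _ (hP _ _))
      · intro f hf
        rw [mem_extensions, mem_colourings] at hf
        simpa [← hf.2 a ha, ← hf.2 b hb] using ⟨⟨hf.1 a x hax, hf.1 b y hby⟩, hf.1 x y hxy⟩
      · intro f f' h h' w hw
        rw [Prod.mk.injEq] at h'
        rcases mem_insert.1 hw with rfl | hw
        · exact h'.1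
        · rcases mem_insert.1 hw with rfl | hw
          exacts [h'.2, h w hw]

lemma card_colourings_le_of_grows [DecidableEq W] {k P : ℕ} (hk : ∀ v, #(H.nbrs v) ≤ k)
    (hP : ∀ i j, #(H.links i j) ≤ P) {w : W} {f g : ℕ} (h : Grows G {w} f g univ) :
    #(colourings G H) ≤ Fintype.card V * (k ^ f * P ^ g) := by
  classical
  rcases (colourings G H).eq_empty_or_nonempty with h0 | ⟨f₀, -⟩
  · rw [h0]; exact Nat.zero_le _
  have h1 : colourings G H = extensions G H ∅ f₀ := by ext; simp
  rw [h1]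
  refine card_extensions_le_mul (B := {w}) (fun f => f w) univ (by simp) (by simp) fun f₁ => ?_
  simpa using h.card_extensions_le hk hP card_extensions_univ_le f₁

lemma LoopGraph.card_links_le {k : ℕ} (hk : ∀ v, #(H.nbrs v) ≤ k) (i j : V) :
    #(H.links i j) ≤ k ^ 2 := by
  classical
  refine (card_filter_le _ _).trans ?_
  rw [card_product, sq]
  exact Nat.mul_le_mul (hk i) (hk j)

/-- A colouring of `b` with at most `l` common neighbours has few extensions if many vertices are
joined to all of `b`. -/
lemma card_extensions_le_of_common_le [DecidableEq W] {δ l c : ℕ} (b : Fin δ ↪ W) {Q : Finset W}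
    (hQ : ∀ q ∈ Q, ∀ i, G.Adj (b i) q) {f₀ : W → V} (hl : #(H.common (f₀ ∘ b)) ≤ l)
    (hc : ∀ f, #(extensions G H (univ.map b ∪ Q) f) ≤ c) :
    #(extensions G H (univ.map b) f₀) ≤ l ^ #Q * c := by
  classical
  refine (card_extensions_le_mul (fun (f : W → V) (q : Q) => f q)
    (Fintype.piFinset fun _ => H.common (f₀ ∘ b)) ?_ ?_ hc).trans (Nat.mul_le_mul_right _ ?_)
  · intro f hf
    rw [mem_extensions, mem_colourings] at hf
    rw [Fintype.mem_piFinset]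
    intro q
    rw [LoopGraph.mem_common]
    intro i
    have := hf.1 _ _ (hQ q q.2 i)
    rwa [hf.2 (b i) (by simp)] at this
  · intro f f' h h' w hw
    rcases mem_union.1 hw with hw | hw
    · exact h w hw
    · exact congrFun h' ⟨w, hw⟩
  · simpa using Nat.pow_le_pow_left hl _

/-- Colourings are split according to whether the vertices of `b` receive a rich tuple. -/
lemma card_colourings_le_add {δ k c₁ c₂ : ℕ} (b : Fin δ ↪ W)
    (h₁ : ∀ f, f ∘ b ∈ H.richTuples k δ → #(extensions G H (univ.map b) f) ≤ c₁)
    (h₂ : ∀ f, f ∘ b ∉ H.richTuples k δ → #(extensions G H (univ.map b) f) ≤ c₂) :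
    #(colourings G H) ≤ #(H.richTuples k δ) * c₁ + Fintype.card V ^ δ * c₂ := by
  classical
  have fib : ∀ (g : Fin δ → V) c, (∀ f, f ∘ b = g → #(extensions G H (univ.map b) f) ≤ c) →
      #{f ∈ colourings G H | f ∘ b = g} ≤ c := by
    intro g c h
    rcases ({f ∈ colourings G H | f ∘ b = g}).eq_empty_or_nonempty with h0 | ⟨f, hf⟩
    · rw [h0]; exact Nat.zero_le _
    · rw [mem_filter] at hf
      refine le_trans (card_le_card fun f' hf' => ?_) (h f hf.2)
      rw [mem_filter] at hf'
      rw [mem_extensions]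
      refine ⟨hf'.1, fun a ha => ?_⟩
      obtain ⟨i, -, rfl⟩ := mem_map.1 ha
      exact congrFun (hf'.2.trans hf.2.symm) i
  rw [← card_filter_add_card_filter_not (s := colourings G H)
    (fun f => f ∘ b ∈ H.richTuples k δ)]
  refine Nat.add_le_add ?_ ?_
  · rw [mul_comm]
    refine card_le_mul_card_image_of_maps_to (f := fun f => f ∘ b)
      (fun f hf => (mem_filter.1 hf).2) _ fun g hg => ?_
    refine (card_le_card (filter_subset_filter _ (filter_subset _ _))).trans (fib g c₁ ?_)
    rintro f rfl
    exact h₁ f hg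
  · have hV : Fintype.card V ^ δ = #(univ : Finset (Fin δ → V)) := by simp
    rw [mul_comm, hV]
    refine card_le_mul_card_image_of_maps_to (f := fun f => f ∘ b)
      (fun f hf => mem_univ _) _ fun g _ => ?_
    by_cases hg : g ∈ H.richTuples k δ
    · rw [filter_filter, filter_eq_empty_iff.2]
      · exact Nat.zero_le _
      · rintro f - ⟨hf, rfl⟩
        exact hf hg
    · refine (card_le_card (filter_subset_filter _ (filter_subset _ _))).trans (fib g c₂ ?_)
      rintro f rfl
      exact h₂ f hg

lemma sum_elim_mem_colourings {δ N : ℕ} {g : Fin δ → V} {q : Fin N → V}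
    (h : ∀ j, q j ∈ H.common g) :
    Sum.elim g q ∈ colourings (completeBipartiteGraph (Fin δ) (Fin N)) H := by
  rw [mem_colourings]
  simp only [LoopGraph.mem_common] at h
  rintro (i | j) (i' | j') huv
  · simp at huv
  · exact h j' i
  · exact H.symm _ _ (h j i')
  · simp at huv

lemma card_richTuples_mul_le (H : LoopGraph V) (k δ N : ℕ) :
    #(H.richTuples k δ) * k ^ N ≤
      #(colourings (completeBipartiteGraph (Fin δ) (Fin N)) H) := by
  classical
  calc #(H.richTuples k δ) * k ^ N
      ≤ ∑ g ∈ H.richTuples k δ, #(Fintype.piFinset fun _ : Fin N => H.common g) := by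
        rw [← smul_eq_mul]
        refine card_nsmul_le_sum _ _ _ fun g hg => ?_
        simpa using Nat.pow_le_pow_left (LoopGraph.mem_richTuples.1 hg) N
    _ = #((H.richTuples k δ).sigma fun g => Fintype.piFinset fun _ : Fin N => H.common g) :=
        (card_sigma _ _).symm
    _ ≤ _ := by
        refine card_le_card_of_injOn (fun p => Sum.elim p.1 p.2) ?_ ?_
        · rintro ⟨g, q⟩ h
          rw [mem_coe, mem_sigma, Fintype.mem_piFinset] at h
          exact sum_elim_mem_colourings h.2
        · rintro ⟨g, q⟩ - ⟨g', q'⟩ - h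
          obtain rfl : g = g' := funext fun i => congrFun h (Sum.inl i)
          obtain rfl : q = q' := funext fun j => congrFun h (Sum.inr j)
          rfl

lemma card_richTuples_pos {k δ : ℕ} {v : V} (hv : k ≤ #(H.nbrs v)) :
    0 < #(H.richTuples k δ) := by
  refine card_pos.2 ⟨fun _ => v, LoopGraph.mem_richTuples.2 (hv.trans (card_le_card fun w hw => ?_))⟩
  simpa using fun _ : Fin δ => LoopGraph.mem_nbrs.1 hw

end Counting

/-! ### Connected targets -/

section Target

variable {V : Type*} [Fintype V] {H : LoopGraph V}

/-- If the neighbourhoods of `i` and `j` have size `k` and are completely joined, then they contain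
all vertices of the connected graph `H`, which is complete looped or complete balanced bipartite. -/
lemma LoopGraph.card_links_lt {k : ℕ} (hconn : ∀ u v, Relation.ReflTransGen H.Adj u v)
    (hk : ∀ v, #(H.nbrs v) ≤ k) (hk0 : 0 < k) (hloop : ¬ H.IsCompleteLooped)
    (hbip : ¬ H.IsCompleteBalancedBipartite) (i j : V) : #(H.links i j) < k ^ 2 := by
  classical
  by_contra! hlinks
  have hle : #(H.links i j) ≤ #(H.nbrs i ×ˢ H.nbrs j) := card_filter_le _ _
  rw [card_product] at hle
  have hi : #(H.nbrs i) = k := by nlinarith [hk i, hk j]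
  have hj : #(H.nbrs j) = k := by nlinarith [hk i, hk j]
  have hjoin : ∀ x ∈ H.nbrs i, ∀ y ∈ H.nbrs j, H.Adj x y := by
    have : H.links i j = H.nbrs i ×ˢ H.nbrs j :=
      eq_of_subset_of_card_le (filter_subset _ _) (by rw [card_product, hi, hj, ← sq]; exact hlinks)
    intro x hx y hy
    exact (LoopGraph.mem_links.1 (this ▸ mem_product.2 ⟨hx, hy⟩ : (x, y) ∈ H.links i j)).2
  have hni : ∀ x ∈ H.nbrs i, H.nbrs x = H.nbrs j := fun x hx =>
    (eq_of_subset_of_card_le (fun y hy => mem_nbrs.2 (hjoin x hx y hy)) (by rw [hj]; exact hk x)).symm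
  have hnj : ∀ y ∈ H.nbrs j, H.nbrs y = H.nbrs i := fun y hy =>
    (eq_of_subset_of_card_le (fun x hx => mem_nbrs.2 (H.symm _ _ (hjoin x hx y hy)))
      (by rw [hi]; exact hk y)).symm
  obtain ⟨x₀, hx₀⟩ : (H.nbrs i).Nonempty := card_pos.1 (hi ▸ hk0)
  have hcover : ∀ v, v ∈ H.nbrs i ∨ v ∈ H.nbrs j := by
    intro v
    induction hconn x₀ v with
    | refl => exact Or.inl hx₀
    | tail _ h ih =>
      rcases ih with ih | ih
      · right; rw [← hni _ ih]; exact mem_nbrs.2 h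
      · left; rw [← hnj _ ih]; exact mem_nbrs.2 h
  by_cases hdisj : Disjoint (H.nbrs i) (H.nbrs j)
  · apply hbip
    have hbij : Function.Bijective
        (Sum.elim (fun x => x.1) (fun y => y.1) : H.nbrs i ⊕ H.nbrs j → V) := by
      constructor
      · refine Function.Injective.sumElim Subtype.val_injective Subtype.val_injective ?_
        intro x y h
        exact disjoint_left.1 hdisj x.2 (h ▸ y.2)
      · intro v
        rcases hcover v with h | h
        exacts [⟨Sum.inl ⟨v, h⟩, rfl⟩, ⟨Sum.inr ⟨v, h⟩, rfl⟩]
    refine ⟨k, ⟨⟨((equivFinOfCardEq hi).symm.sumCongr (equivFinOfCardEq hj).symm).trans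
      (Equiv.ofBijective _ hbij), ?_⟩⟩⟩
    have h1 : ∀ x ∈ H.nbrs i, ∀ y ∈ H.nbrs i, ¬ H.Adj x y := fun x hx y hy h =>
      disjoint_left.1 hdisj hy (hni x hx ▸ mem_nbrs.2 h)
    have h2 : ∀ x ∈ H.nbrs j, ∀ y ∈ H.nbrs j, ¬ H.Adj x y := fun x hx y hy h =>
      disjoint_left.1 hdisj (hnj x hx ▸ mem_nbrs.2 h) hy
    rintro (a | a) (b | b)
    · simpa using h1 _ (Subtype.prop _) _ (Subtype.prop _)
    · simpa using hjoin _ (Subtype.prop _) _ (Subtype.prop _)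
    · simpa using H.symm _ _ (hjoin _ (Subtype.prop _) _ (Subtype.prop _))
    · simpa using h2 _ (Subtype.prop _) _ (Subtype.prop _)
  · obtain ⟨x, hxi, hxj⟩ := not_disjoint_iff.1 hdisj
    have hij : H.nbrs i = H.nbrs j := by rw [← hni x hxi, hnj x hxj]
    apply hloop
    intro u v
    have h : ∀ v, v ∈ H.nbrs j := fun v => by simpa [hij] using hcover v
    exact hjoin u (hij ▸ h u) v (h v)

/-- In a connected `H` that is not complete looped, some colouring of a complete bipartite graph
maps two given vertices of the same class to non-adjacent vertices. -/
lemma exists_colouring_not_adj (hconn : ∀ u v, Relation.ReflTransGen H.Adj u v)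
    (hedge : H.HasEdge) (hloop : ¬ H.IsCompleteLooped) {δ N : ℕ} {i j : Fin δ} (hij : i ≠ j) :
    ∃ f ∈ colourings (completeBipartiteGraph (Fin δ) (Fin N)) H,
      ¬ H.Adj (f (Sum.inl i)) (f (Sum.inl j)) := by
  classical
  by_cases hv : ∃ v, ¬ H.Adj v v
  · obtain ⟨v, hv⟩ := hv
    obtain ⟨w, hw⟩ : ∃ w, H.Adj v w := by
      obtain ⟨a, b, hab⟩ := hedge
      rcases Relation.ReflTransGen.cases_head (hconn v a) with rfl | ⟨c, h, -⟩
      exacts [⟨b, hab⟩, ⟨c, h⟩]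
    exact ⟨_, sum_elim_mem_colourings (g := fun _ => v) (q := fun _ => w) (by simpa using
      fun _ _ => hw), hv⟩
  · push Not at hv
    -- all vertices are looped, and some path `u w v` is induced
    obtain ⟨u, w, v, huw, hwv, huv⟩ : ∃ u w v, H.Adj u w ∧ H.Adj w v ∧ ¬ H.Adj u v := by
      by_contra! h
      refine hloop fun u v => ?_
      induction hconn u v with
      | refl => exact hv u
      | tail _ h' ih => exact h _ _ _ ih h'
    refine ⟨_, sum_elim_mem_colourings
      (g := fun l => if l = i then u else if l = j then v else w) (q := fun _ => w) ?_, ?_⟩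
    · intro _
      rw [LoopGraph.mem_common]
      intro l
      split_ifs
      exacts [huw, H.symm _ _ hwv, hv w]
    · simpa [hij.symm] using huv

end Target

/-! ### Elementary asymptotics -/

lemma exists_mul_pow_lt {a b : ℕ} (hab : a < b) (c : ℕ) : ∃ m, c * a ^ m < b ^ m := by
  have hb : (0 : ℝ) < b := by exact_mod_cast (Nat.zero_le a).trans_lt hab
  obtain ⟨m, hm⟩ := exists_pow_lt_of_lt_one (show (0 : ℝ) < 1 / (c + 1) by positivity)
    (show (a : ℝ) / b < 1 by rw [div_lt_one hb]; exact_mod_cast hab)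
  refine ⟨m, ?_⟩
  rw [div_pow, div_lt_div_iff₀ (by positivity) (by positivity)] at hm
  have h : (c : ℝ) * a ^ m < b ^ m := by nlinarith [show (0 : ℝ) ≤ (a : ℝ) ^ m by positivity]
  exact_mod_cast h

lemma exists_log_pow_lt (a b c e : ℕ) :
    ∃ κ : ℕ, ∀ n : ℕ, κ ≤ n → c * (a + b * Nat.log 2 n) ^ e + (a + b * Nat.log 2 n) < n := by
  set C := c * (a + b) ^ e + (a + b) with hC
  have hlim := tendsto_pow_const_div_const_pow_of_one_lt (e + 1) (one_lt_two (α := ℝ))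
  obtain ⟨L, hL⟩ := Filter.eventually_atTop.1
    (hlim.eventually_lt_const (show (0 : ℝ) < 1 / (C + 1) by positivity))
  refine ⟨2 ^ (L + 1), fun n hn => ?_⟩
  set l := Nat.log 2 n with hl
  have hn0 : n ≠ 0 := by
    have := Nat.two_pow_pos (L + 1)
    omega
  have hlL : L + 1 ≤ l := Nat.le_log_of_pow_le one_lt_two hn
  have hln : 2 ^ l ≤ n := Nat.pow_log_le_self 2 hn0
  have h1 : C * l ^ (e + 1) < 2 ^ l := by
    have := hL l (by omega)
    rw [div_lt_div_iff₀ (by positivity) (by positivity)] at this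
    have h : (C : ℝ) * l ^ (e + 1) < 2 ^ l := by
      nlinarith [show (0 : ℝ) ≤ (l : ℝ) ^ (e + 1) by positivity]
    exact_mod_cast h
  have h2 : a + b * l ≤ (a + b) * l := by
    rw [add_mul]
    exact Nat.add_le_add_right (Nat.le_mul_of_pos_right a (by omega)) _
  have h3 : c * (a + b * l) ^ e ≤ c * (a + b) ^ e * l ^ (e + 1) := by
    rw [mul_assoc]
    refine Nat.mul_le_mul_left c ((Nat.pow_le_pow_left h2 e).trans ?_)
    rw [mul_pow]
    exact Nat.mul_le_mul_left _ (Nat.pow_le_pow_right (by omega) (by omega))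
  have h4 : (a + b) * l ≤ (a + b) * l ^ (e + 1) :=
    Nat.mul_le_mul_left _ (Nat.le_self_pow (by omega) l)
  rw [hC, add_mul] at h1
  omega

/-! ### Graphs covered by a small vertex set -/

section Structure

variable {W : Type*} [Fintype W] {G : SimpleGraph W}

/-- If a small set meets all edges, then many vertices are joined to the same `δ` vertices. -/
lemma exists_common_nbrs [DecidableEq W] [DecidableRel G.Adj] {δ m : ℕ} (hdeg : ∀ v, δ ≤ G.degree v)
    {A : Finset W} (hA : ∀ y z, G.Adj y z → y ∈ A ∨ z ∈ A)
    (hc : m * #A ^ δ + #A < Fintype.card W) :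
    ∃ (b : Fin δ ↪ W) (Q : Finset W), #Q = m ∧ Disjoint (univ.map b) Q ∧
      ∀ q ∈ Q, ∀ i, G.Adj (b i) q := by
  have h : ∀ v, ∃ B ⊆ G.neighborFinset v, #B = δ := fun v => exists_subset_card_eq (hdeg v)
  choose B hB hBc using h
  have hmaps : ∀ v ∈ Aᶜ, B v ∈ A.powersetCard δ := fun v hv => by
    rw [mem_powersetCard]
    refine ⟨fun w hw => ?_, hBc v⟩
    exact (hA v w (by simpa using hB v hw)).resolve_left (mem_compl.1 hv)
  have hlt : #(A.powersetCard δ) * m < #Aᶜ := by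
    rw [card_powersetCard, card_compl]
    have := Nat.mul_le_mul_right m (Nat.choose_le_pow (#A) δ)
    rw [mul_comm (#A ^ δ)] at this
    omega
  obtain ⟨S, hS, hSm⟩ := exists_lt_card_fiber_of_mul_lt_card_of_maps_to hmaps hlt
  obtain ⟨Q, hQ, hQm⟩ := exists_subset_card_eq hSm.le
  rw [mem_powersetCard] at hS
  have hQ' : ∀ q ∈ Q, q ∉ A ∧ B q = S := fun q hq => by simpa using hQ hq
  have hb : univ.map ((S.equivFinOfCardEq hS.2).symm.toEmbedding.trans
      (Function.Embedding.subtype _)) = S := by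
    rw [← map_map, map_univ_equiv]
    exact attach_map_val
  refine ⟨(S.equivFinOfCardEq hS.2).symm.toEmbedding.trans (Function.Embedding.subtype _),
    Q, hQm, ?_, ?_⟩
  · rw [hb, disjoint_left]
    exact fun s hs hq => (hQ' s hq).1 (hS.1 hs)
  · intro q hq i
    have : (((S.equivFinOfCardEq hS.2).symm i : S) : W) ∈ B q := by
      rw [(hQ' q hq).2]; exact Subtype.prop _
    simpa using (G.adj_symm (by simpa using hB q this) : G.Adj _ q)

/-- If `δ` vertices meet all edges of a graph of minimum degree at least `δ`, then the graph
contains the complete bipartite graph between these vertices and the others. -/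
lemma exists_equiv_of_cover [DecidableRel G.Adj] {δ N : ℕ} (hdeg : ∀ v, δ ≤ G.degree v)
    (b : Fin δ ↪ W) (hN : Fintype.card W = δ + N)
    (hcov : ∀ y z, G.Adj y z → y ∈ univ.map b ∨ z ∈ univ.map b) :
    ∃ e : Fin δ ⊕ Fin N ≃ W, ∀ x y,
      (completeBipartiteGraph (Fin δ) (Fin N)).Adj x y ∨
        (∃ i j, x = Sum.inl i ∧ y = Sum.inl j ∧ G.Adj (e x) (e y)) ↔ G.Adj (e x) (e y) := by
  classical
  have hcard : #(univ.map b)ᶜ = N := by rw [card_compl, card_map, card_univ, Fintype.card_fin]; omega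
  set e₂ := ((univ.map b)ᶜ.equivFinOfCardEq hcard).symm with he₂
  have hbij : Function.Bijective (Sum.elim b (fun j => (e₂ j : W))) := by
    rw [Fintype.bijective_iff_injective_and_card]
    refine ⟨Function.Injective.sumElim b.injective
      (Subtype.val_injective.comp e₂.injective) ?_, by simp [hN]⟩
    intro i j h
    have := (e₂ j).2
    rw [← h] at this
    simp at this
  have hnot : ∀ j, (e₂ j : W) ∉ univ.map b := fun j => mem_compl.1 (e₂ j).2
  have hadj : ∀ i j, G.Adj (b i) (e₂ j) := by
    intro i j
    have hsub : G.neighborFinset (e₂ j) ⊆ univ.map b := fun w hw =>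
      (hcov _ w (by simpa using hw)).resolve_left (hnot j)
    have heq := eq_of_subset_of_card_le hsub (by simpa using hdeg (e₂ j))
    have : b i ∈ G.neighborFinset (e₂ j) := by rw [heq]; simp
    exact (by simpa using this : G.Adj (e₂ j) (b i)).symm
  refine ⟨Equiv.ofBijective _ hbij, ?_⟩
  rintro (i | i) (j | j)
  · simp
  · simpa using hadj i j
  · simpa using (hadj j i).symm
  · simp only [completeBipartiteGraph_adj, Equiv.ofBijective_apply, Sum.elim_inr]
    have : ¬ G.Adj (e₂ i) (e₂ j) := fun h => (hcov _ _ h).elim (hnot i) (hnot j)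
    simpa using this

end Structure

/-! ### The bound for connected targets -/

lemma homCount_congr {W W' V : Type*} {G : SimpleGraph W} {G' : SimpleGraph W'} (e : G ≃g G')
    (H : LoopGraph V) : homCount G H = homCount G' H :=
  Nat.card_congr
    { toFun := fun f => f.comp e.symm.toRelEmbedding.toRelHom
      invFun := fun f => f.comp e.toRelEmbedding.toRelHom
      left_inv := fun f => by ext; simp
      right_inv := fun f => by ext; simp }

section ConnectedTarget

variable {V : Type*} [Fintype V] {H : LoopGraph V}

/-- The case where the given copy of `K_{δ, m}` does not meet all edges: outside the `δ` vertices
there is a pair step, which costs a factor `P / k ^ 2` for the rich tuples, while the poor tuples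
are negligible because of the `m` common neighbours. -/
lemma card_colourings_lt_of_common_nbrs {W : Type*} [Fintype W] [DecidableEq W]
    {G : SimpleGraph W} [DecidableRel G.Adj]
    (hG : G.Connected) {δ k P m : ℕ} (hδ : 3 ≤ δ) (hdeg : ∀ v, δ ≤ G.degree v)
    (hk : ∀ v, #(H.nbrs v) ≤ k) (hk0 : 0 < k) {v₀ : V} (hv₀ : k ≤ #(H.nbrs v₀))
    (hP : ∀ i j, #(H.links i j) ≤ P) (hPk : P < k ^ 2)
    (hm : Fintype.card V ^ δ * k ^ 2 * (k - 1) ^ m < k ^ m)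
    (b : Fin δ ↪ W) {Q : Finset W} (hQm : #Q = m) (hbQ : Disjoint (univ.map b) Q)
    (hQ : ∀ q ∈ Q, ∀ i, G.Adj (b i) q) {y z : W} (hyz : G.Adj y z)
    (hy : y ∉ univ.map b) (hz : z ∉ univ.map b) :
    #(colourings G H) < #(H.richTuples k δ) * k ^ (Fintype.card W - δ) := by
  have hB : (univ.map b).Nonempty := ⟨b ⟨0, by omega⟩, by simp⟩
  have hBc : #(univ.map b) = δ := by simp
  obtain ⟨f₁, C, hC, -⟩ := exists_short_pair hG (fun v => hδ.trans (hdeg v)) hB hy hz hyz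
    (Nat.lt_two_pow_self (n := Fintype.card W))
  obtain ⟨f₂, hf₂⟩ := exists_grows_univ hG (hB.mono hC.subset)
  obtain ⟨e, he⟩ := exists_grows_univ hG (hB.mono (subset_union_left (s₂ := Q)))
  obtain ⟨f, hf⟩ : ∃ f, Grows G (univ.map b) f 1 univ := ⟨_, hC.trans hf₂⟩
  have hcf := hf.card
  have hce := he.card
  rw [card_union_of_disjoint hbQ, hBc, hQm, card_univ] at hce
  rw [hBc, card_univ] at hcf
  have hmain := card_colourings_le_add (G := G) (H := H) (k := k) b (c₁ := k ^ f * P)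
    (c₂ := (k - 1) ^ m * k ^ e) ?_ ?_
  · have hs := card_richTuples_pos (δ := δ) hv₀
    set s := #(H.richTuples k δ)
    -- the poor tuples together cost less than the unit by which `P` falls short of `k ^ 2`
    have hbad : Fintype.card V ^ δ * ((k - 1) ^ m * k ^ e) < k ^ f := by
      refine lt_of_mul_lt_mul_right (a := k ^ 2) ?_ (Nat.zero_le _)
      calc Fintype.card V ^ δ * ((k - 1) ^ m * k ^ e) * k ^ 2
          = Fintype.card V ^ δ * k ^ 2 * (k - 1) ^ m * k ^ e := by ring
        _ < k ^ m * k ^ e := Nat.mul_lt_mul_of_pos_right hm (by positivity)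
        _ = k ^ f * k ^ 2 := by rw [← pow_add, ← pow_add]; congr 1; omega
    have hn : Fintype.card W - δ = f + 2 := by omega
    calc #(colourings G H) ≤ s * (k ^ f * P) + Fintype.card V ^ δ * ((k - 1) ^ m * k ^ e) := hmain
      _ < s * (k ^ f * P) + s * k ^ f :=
        Nat.add_lt_add_left (hbad.trans_le (Nat.le_mul_of_pos_left _ hs)) _
      _ = s * (k ^ f * (P + 1)) := by ring
      _ ≤ s * k ^ (Fintype.card W - δ) := by
        rw [hn, pow_add]
        exact Nat.mul_le_mul_left _ (Nat.mul_le_mul_left _ hPk)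
  · intro f₀ _
    simpa using hf.card_extensions_le hk hP card_extensions_univ_le f₀
  · intro f₀ hf₀
    rw [LoopGraph.mem_richTuples, not_le] at hf₀
    have := card_extensions_le_of_common_le (c := k ^ e) b hQ (Nat.le_sub_one_of_lt hf₀)
      (fun f => by simpa using he.card_extensions_le hk hP card_extensions_univ_le f)
    rwa [hQm] at this

/-- The case where `δ` vertices meet all edges: then `G` is the complete bipartite graph, possibly
with additional edges in the class of size `δ`, each of which forbids some colouring. -/
lemma card_colourings_lt_or_iso_of_cover {W : Type*} [Fintype W] {G : SimpleGraph W}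
    [DecidableRel G.Adj] {δ N : ℕ} (hdeg : ∀ v, δ ≤ G.degree v)
    (hconn : ∀ u v, Relation.ReflTransGen H.Adj u v) (hedge : H.HasEdge)
    (hloop : ¬ H.IsCompleteLooped) (b : Fin δ ↪ W) (hN : Fintype.card W = δ + N)
    (hcov : ∀ y z, G.Adj y z → y ∈ univ.map b ∨ z ∈ univ.map b) :
    Nonempty (G ≃g completeBipartiteGraph (Fin δ) (Fin N)) ∨
      #(colourings G H) < #(colourings (completeBipartiteGraph (Fin δ) (Fin N)) H) := by
  classical
  obtain ⟨e, he⟩ := exists_equiv_of_cover hdeg b hN hcov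
  by_cases h : ∃ i j, G.Adj (e (Sum.inl i)) (e (Sum.inl j))
  · right
    obtain ⟨i, j, hij⟩ := h
    obtain ⟨f, hf, hfij⟩ := exists_colouring_not_adj (N := N) hconn hedge hloop (i := i) (j := j)
      (by rintro rfl; exact hij.ne rfl)
    rw [← card_image_of_injective (colourings G H)
      (f := fun f => f ∘ e) e.surjective.injective_comp_right]
    refine card_lt_card ((ssubset_iff_of_subset ?_).2 ⟨f, hf, ?_⟩)
    · intro f' hf'
      obtain ⟨f, hf, rfl⟩ := mem_image.1 hf'
      rw [mem_colourings] at hf ⊢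
      exact fun u v huv => hf _ _ ((he u v).1 (Or.inl huv))
    · intro hf'
      obtain ⟨f', hf'', rfl⟩ := mem_image.1 hf'
      exact hfij (mem_colourings.1 hf'' _ _ hij)
  · left
    refine ⟨(RelIso.symm ⟨e, fun {x y} => ?_⟩ : G ≃g completeBipartiteGraph (Fin δ) (Fin N))⟩
    rw [← he x y]
    refine ⟨fun h' => h'.resolve_right ?_, Or.inl⟩
    rintro ⟨i, j, rfl, rfl, h'⟩
    exact h ⟨i, j, h'⟩

/-- The strict bound for connected targets that are neither complete looped nor complete balanced
bipartite: the many-pair-steps case and the small-cover case are combined. -/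
lemma exists_card_colourings_lt (δ : ℕ) (hδ : 3 ≤ δ)
    (hconn : ∀ u v, Relation.ReflTransGen H.Adj u v) (hedge : H.HasEdge)
    (hloop : ¬ H.IsCompleteLooped) (hbip : ¬ H.IsCompleteBalancedBipartite) :
    ∃ κ : ℕ, ∀ (W : Type*) [Fintype W] (G : SimpleGraph W) [DecidableRel G.Adj],
      κ ≤ Fintype.card W → G.Connected → (∀ v, δ ≤ G.degree v) →
      Nonempty (G ≃g completeBipartiteGraph (Fin δ) (Fin (Fintype.card W - δ))) ∨
        #(colourings G H) <
          #(colourings (completeBipartiteGraph (Fin δ) (Fin (Fintype.card W - δ))) H) := by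
  classical
  obtain ⟨a₀, b₀, hab₀⟩ := hedge
  obtain ⟨v₀, -, hv₀⟩ := exists_max_image univ (fun v => #(H.nbrs v)) ⟨a₀, mem_univ _⟩
  set k := #(H.nbrs v₀) with hkdef
  have hk : ∀ v, #(H.nbrs v) ≤ k := fun v => hv₀ v (mem_univ _)
  have hk0 : 0 < k := (card_pos.2 ⟨b₀, LoopGraph.mem_nbrs.2 hab₀⟩).trans_le (hk a₀)
  have hP : ∀ i j, #(H.links i j) ≤ k ^ 2 - 1 := fun i j =>
    Nat.le_sub_one_of_lt (LoopGraph.card_links_lt hconn hk hk0 hloop hbip i j)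
  have hPk : k ^ 2 - 1 < k ^ 2 := Nat.sub_lt (by positivity) one_pos
  set P := k ^ 2 - 1
  -- `M` pair steps outweigh all constant factors, as do `m` common neighbours of a poor tuple
  obtain ⟨M, hM⟩ := exists_mul_pow_lt hPk (Fintype.card V * k ^ δ)
  obtain ⟨m, hm⟩ := exists_mul_pow_lt (Nat.sub_lt hk0 one_pos) (Fintype.card V ^ δ * k ^ 2)
  obtain ⟨κ, hκ⟩ := exists_log_pow_lt (1 + M * 5) (M * 2) m δ
  refine ⟨κ, fun W _ G _ hn hG hdeg => ?_⟩
  obtain ⟨w⟩ := hG.nonempty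
  have hδn : δ < Fintype.card W := (hdeg w).trans_lt (G.degree_lt_card_verts w)
  rcases grows_or_cover hG (fun v => hδ.trans (hdeg v)) w
    (Nat.lt_pow_succ_log_self one_lt_two (Fintype.card W)) M with ⟨f, hf⟩ | ⟨A, hAc, hA⟩
  · right
    have hc := hf.card
    rw [card_univ, card_singleton] at hc
    refine (card_colourings_le_of_grows hk hP hf).trans_lt
      (lt_of_lt_of_le ?_ (card_richTuples_mul_le H k δ _))
    refine lt_of_lt_of_le ?_ (Nat.le_mul_of_pos_left _ (card_richTuples_pos hkdef.le))
    refine lt_of_mul_lt_mul_right (a := k ^ δ) ?_ (Nat.zero_le _)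
    calc Fintype.card V * (k ^ f * P ^ M) * k ^ δ = Fintype.card V * k ^ δ * P ^ M * k ^ f := by ring
      _ < (k ^ 2) ^ M * k ^ f := Nat.mul_lt_mul_of_pos_right hM (by positivity)
      _ = k ^ (2 * M + f) := by rw [← pow_mul, ← pow_add]
      _ ≤ k ^ Fintype.card W := Nat.pow_le_pow_right hk0 (by omega)
      _ = k ^ (Fintype.card W - δ) * k ^ δ := by rw [← pow_add, Nat.sub_add_cancel hδn.le]
  · have hAc' : #A ≤ 1 + M * 5 + M * 2 * Nat.log 2 (Fintype.card W) := 
      hAc.trans (le_of_eq (by rw [Nat.succ_eq_add_one]; ring))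
    obtain ⟨b, Q, hQm, hbQ, hQ⟩ := exists_common_nbrs (m := m) hdeg hA
      (lt_of_le_of_lt (Nat.add_le_add (Nat.mul_le_mul_left _ (Nat.pow_le_pow_left hAc' _)) hAc')
        (hκ _ hn))
    by_cases hcov : ∀ y z, G.Adj y z → y ∈ univ.map b ∨ z ∈ univ.map b
    · exact card_colourings_lt_or_iso_of_cover hdeg hconn ⟨a₀, b₀, hab₀⟩ hloop b (by omega) hcov
    · push Not at hcov
      obtain ⟨y, z, hyz, hy, hz⟩ := hcov
      exact Or.inr ((card_colourings_lt_of_common_nbrs hG hδ hdeg hk hk0 hkdef.le hP hPk hm b hQm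
        hbQ hQ hyz hy hz).trans_le (card_richTuples_mul_le H k δ _))

lemma card_colourings_le_of_completeLooped {W : Type*} [Fintype W] {G : SimpleGraph W} {δ N : ℕ}
    (hloop : H.IsCompleteLooped) (hN : Fintype.card W = δ + N) :
    #(colourings G H) ≤ #(colourings (completeBipartiteGraph (Fin δ) (Fin N)) H) := by
  classical
  have h : colourings (completeBipartiteGraph (Fin δ) (Fin N)) H = univ := by
    ext f; simpa only [mem_colourings, mem_univ, iff_true] using fun u v _ => hloop _ _
  calc #(colourings G H) ≤ Fintype.card (W → V) := card_le_univ _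
    _ = _ := by rw [h, card_univ]; simp [hN]

/-- For `H = K_{r,r}` both numbers are at most `2 r ^ n`, with equality for bipartite graphs. -/
lemma card_colourings_le_of_completeBalancedBipartite {W : Type*} [Fintype W] {G : SimpleGraph W}
    {δ N : ℕ} (hG : G.Connected) (hbip : H.IsCompleteBalancedBipartite)
    (hδ : 0 < δ) (hN : Fintype.card W = δ + N) :
    #(colourings G H) ≤ #(colourings (completeBipartiteGraph (Fin δ) (Fin N)) H) := by
  classical
  obtain ⟨r, ⟨e⟩⟩ := hbip
  have hV : Fintype.card V = 2 * r := by
    rw [← Fintype.card_congr e.toEquiv]; simp [two_mul]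
  have hk : ∀ v, #(H.nbrs v) ≤ r := by
    intro v
    obtain ⟨x, rfl⟩ := e.surjective v
    have hx : ∃ φ : Fin r → Fin r ⊕ Fin r, ∀ y, (completeBipartiteGraph _ _).Adj x y →
        ∃ i, φ i = y := by
      rcases x with x | x
      · exact ⟨Sum.inr, by rintro (y | y) <;> simp⟩
      · exact ⟨Sum.inl, by rintro (y | y) <;> simp⟩
    obtain ⟨φ, hφ⟩ := hx
    have : H.nbrs (e x) ⊆ univ.image (e ∘ φ) := by
      intro y hy
      obtain ⟨y, rfl⟩ := e.surjective y
      obtain ⟨i, rfl⟩ := hφ y (e.map_rel_iff.1 (LoopGraph.mem_nbrs.1 hy))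
      exact mem_image_of_mem _ (mem_univ i)
    exact (card_le_card this).trans (card_image_le.trans (by simp))
  obtain ⟨w⟩ := hG.nonempty
  obtain ⟨f, hf⟩ := exists_grows_univ hG (singleton_nonempty w)
  have hc := hf.card
  rw [card_univ, card_singleton] at hc
  calc #(colourings G H) ≤ 2 * r * r ^ f := by
        simpa [hV] using card_colourings_le_of_grows hk (LoopGraph.card_links_le hk) hf
    _ = Fintype.card (Bool × (Fin δ → Fin r) × (Fin N → Fin r)) := by
        simp only [Fintype.card_prod, Fintype.card_bool, Fintype.card_fun, Fintype.card_fin]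
        rw [← pow_add, mul_assoc, ← pow_succ']
        congr 2; omega
    _ ≤ _ := by
        let side : Bool → Fin r → Fin r ⊕ Fin r := fun s i => cond s (Sum.inl i) (Sum.inr i)
        rw [← card_univ]
        refine card_le_card_of_injOn
          (fun p => Sum.elim (fun i => e (side p.1 (p.2.1 i))) (fun j => e (side (!p.1) (p.2.2 j))))
          ?_ ?_
        · rintro ⟨s, p, q⟩ -
          refine sum_elim_mem_colourings fun j => LoopGraph.mem_common.2 fun i => ?_
          rw [e.map_rel_iff]
          cases s <;> simp [side]
        · rintro ⟨s, p, q⟩ - ⟨s', p', q'⟩ - h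
          have hside : ∀ s s' i i', side s i = side s' i' → s = s' ∧ i = i' := by
            rintro (_ | _) (_ | _) i i' h <;> simp_all [side]
          have hp : ∀ i, s = s' ∧ p i = p' i := fun i =>
            hside _ _ _ _ (e.injective (congrFun h (Sum.inl i)))
          have hq : ∀ j, q j = q' j := fun j =>
            (hside _ _ _ _ (e.injective (congrFun h (Sum.inr j)))).2
          rw [(hp ⟨0, hδ⟩).1, funext fun i => (hp i).2, funext hq]

/-- The theorem for connected `H`. -/
lemma exists_homCount_le_of_connected (δ : ℕ) (hδ : 3 ≤ δ)
    (hconn : ∀ u v, Relation.ReflTransGen H.Adj u v) :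
    ∃ κ : ℕ, ∀ (W : Type*) [Fintype W] (G : SimpleGraph W) [DecidableRel G.Adj],
      κ ≤ Fintype.card W → G.Connected → (∀ v, δ ≤ G.degree v) →
      homCount G H ≤ homCount (completeBipartiteGraph (Fin δ) (Fin (Fintype.card W - δ))) H ∧
      (H.HasEdge → ¬ H.IsCompleteLooped → ¬ H.IsCompleteBalancedBipartite →
        homCount G H = homCount (completeBipartiteGraph (Fin δ) (Fin (Fintype.card W - δ))) H →
        Nonempty (G ≃g completeBipartiteGraph (Fin δ) (Fin (Fintype.card W - δ)))) := by
  classical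
  by_cases hedge : H.HasEdge
  swap
  · refine ⟨0, fun W _ G _ _ hG hdeg => ⟨?_, fun h => absurd h hedge⟩⟩
    obtain ⟨w⟩ := hG.nonempty
    obtain ⟨x, hx⟩ : (G.neighborFinset w).Nonempty := card_pos.1 (by have := hdeg w; simp; omega)
    rw [homCount_eq_card_colourings G, eq_empty_of_forall_notMem (s := colourings G H)]
    · exact Nat.zero_le _
    · exact fun f hf => hedge ⟨_, _, mem_colourings.1 hf w x (by simpa using hx)⟩
  have hcard : ∀ (W : Type _) [Fintype W] (G : SimpleGraph W) [DecidableRel G.Adj],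
      G.Connected → (∀ v, δ ≤ G.degree v) → Fintype.card W = δ + (Fintype.card W - δ) := by
    intro W _ G _ hG hdeg
    obtain ⟨w⟩ := hG.nonempty
    have := (hdeg w).trans_lt (G.degree_lt_card_verts w)
    omega
  by_cases hloop : H.IsCompleteLooped
  · refine ⟨0, fun W _ G _ _ hG hdeg => ⟨?_, fun _ h => absurd hloop h⟩⟩
    rw [homCount_eq_card_colourings, homCount_eq_card_colourings]
    exact card_colourings_le_of_completeLooped hloop (hcard W G hG hdeg)
  by_cases hbip : H.IsCompleteBalancedBipartite
  · refine ⟨0, fun W _ G _ _ hG hdeg => ⟨?_, fun _ _ h => absurd hbip h⟩⟩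
    rw [homCount_eq_card_colourings, homCount_eq_card_colourings]
    exact card_colourings_le_of_completeBalancedBipartite hG hbip (by omega) (hcard W G hG hdeg)
  obtain ⟨κ, hκ⟩ := exists_card_colourings_lt δ hδ hconn hedge hloop hbip
  refine ⟨κ, fun W _ G _ hn hG hdeg => ?_⟩
  rcases hκ W G hn hG hdeg with h | h
  · exact ⟨(homCount_congr h.some H).le, fun _ _ _ _ => h⟩
  · rw [homCount_eq_card_colourings, homCount_eq_card_colourings]
    exact ⟨h.le, fun _ _ _ h' => absurd h' h.ne⟩

end ConnectedTarget

/-! ### Reduction to connected targets -/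

section Components

variable {V : Type*} {H : LoopGraph V}

lemma LoopGraph.reflTransGen_symm (H : LoopGraph V) {u v : V}
    (h : Relation.ReflTransGen H.Adj u v) : Relation.ReflTransGen H.Adj v u :=
  (Relation.reflTransGen_swap.2 h).lift id fun a b h => H.symm b a h

lemma LoopGraph.IsComponent.eq_of_mem {C : Set V} (hC : H.IsComponent C) {u : V} (hu : u ∈ C) :
    C = {w | Relation.ReflTransGen H.Adj u w} := by
  obtain ⟨v, rfl⟩ := hC
  ext w
  exact ⟨fun hw => (H.reflTransGen_symm hu).trans hw, fun hw => Relation.ReflTransGen.trans hu hw⟩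

lemma LoopGraph.IsComponent.connected {C : Set V} (hC : H.IsComponent C) (u v : C) :
    Relation.ReflTransGen (H.induce C).Adj u v := by
  obtain ⟨u, hu⟩ := u
  obtain ⟨v, hv⟩ := v
  have h : Relation.ReflTransGen H.Adj u v := by rw [hC.eq_of_mem hu] at hv; exact hv
  induction h with
  | refl => exact .refl
  | @tail b c hb hbc ih =>
    have hbC : b ∈ C := by rw [hC.eq_of_mem hu]; exact hb
    exact (ih hbC).tail hbc

/-- A colouring of a connected graph uses the vertices of only one component of `H`. -/
lemma homCount_eq_sum_components [Finite V] {W : Type*} [Finite W] {G : SimpleGraph W}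
    (hG : G.Connected) [Fintype {C : Set V // H.IsComponent C}] :
    homCount G H = ∑ C : {C : Set V // H.IsComponent C}, homCount G (H.induce C.1) := by
  have hfin : ∀ C : {C : Set V // H.IsComponent C}, Finite (G.Adj →r (H.induce C.1).Adj) :=
    fun C => Finite.of_injective _ (DFunLike.coe_injective (F := G.Adj →r (H.induce C.1).Adj))
  simp only [homCount]
  rw [← Nat.card_sigma]
  obtain ⟨w⟩ := hG.nonempty
  refine (Nat.card_congr (Equiv.ofBijective (fun p : (C : {C : Set V // H.IsComponent C}) ×
    (G.Adj →r (H.induce C.1).Adj) => (⟨fun x => (p.2 x).1, fun h => p.2.map_rel h⟩ :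
      G.Adj →r H.Adj)) ⟨?_, ?_⟩)).symm
  · rintro ⟨⟨C, hC⟩, f⟩ ⟨⟨C', hC'⟩, f'⟩ h
    have hval : ∀ x, (f x).1 = (f' x).1 := fun x => DFunLike.congr_fun h x
    obtain rfl : C = C' := by
      rw [hC.eq_of_mem (f w).2, hC'.eq_of_mem (f' w).2, hval w]
    obtain rfl : f = f' := RelHom.ext fun x => Subtype.ext (hval x)
    rfl
  · intro f
    have hf : ∀ x, Relation.ReflTransGen H.Adj (f w) (f x) := fun x =>
      ((G.reachable_iff_reflTransGen w x).1 (hG.preconnected w x)).lift f fun _ _ h => f.map_rel h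
    exact ⟨⟨⟨_, f w, rfl⟩, ⟨fun x => ⟨f x, hf x⟩, fun h => f.map_rel h⟩⟩, rfl⟩

lemma completeBipartiteGraph_connected {δ N : ℕ} (hδ : 0 < δ) (hN : 0 < N) :
    (completeBipartiteGraph (Fin δ) (Fin N)).Connected := by
  rw [SimpleGraph.connected_iff_exists_forall_reachable]
  have h : ∀ i j, (completeBipartiteGraph (Fin δ) (Fin N)).Adj (Sum.inl i) (Sum.inr j) := by simp
  refine ⟨Sum.inl ⟨0, hδ⟩, ?_⟩
  rintro (i | j)
  · exact (h _ ⟨0, hN⟩).reachable.trans (h i _).symm.reachable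
  · exact (h _ j).reachable

end Components

theorem corollary1p2 {V : Type*} [Finite V] (δ : ℕ) (hδ : 3 ≤ δ) (H : LoopGraph V) :
    ∃ κ : ℕ, ∀ n : ℕ, κ ≤ n →
      ∀ (W : Type*) [Fintype W] (G : SimpleGraph W) [DecidableRel G.Adj],
        Fintype.card W = n → G.Connected → δ ≤ G.minDegree →
        homCount G H ≤ homCount (completeBipartiteGraph (Fin δ) (Fin (n - δ))) H ∧
        ((∃ C : Set V, H.IsComponent C ∧ (H.induce C).HasEdge ∧
            ¬ (H.induce C).IsCompleteLooped ∧ ¬ (H.induce C).IsCompleteBalancedBipartite) →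
          (homCount G H = homCount (completeBipartiteGraph (Fin δ) (Fin (n - δ))) H ↔
            Nonempty (G ≃g completeBipartiteGraph (Fin δ) (Fin (n - δ))))) := by
  classical
  have := Fintype.ofFinite V
  -- one threshold for all of the finitely many components
  choose κ hκ using fun C : {C : Set V // H.IsComponent C} =>
    exists_homCount_le_of_connected (H := H.induce C.1) δ hδ C.2.connected
  refine ⟨∑ C, κ C, ?_⟩
  rintro n hn W _ G _ rfl hG hδG
  have hdeg : ∀ v, δ ≤ G.degree v := fun v => hδG.trans (G.minDegree_le_degree v)
  obtain ⟨w⟩ := hG.nonempty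
  have hδn := (hdeg w).trans_lt (G.degree_lt_card_verts w)
  have hκn : ∀ C, κ C ≤ Fintype.card W := fun C =>
    (single_le_sum (fun _ _ => Nat.zero_le _) (mem_univ C)).trans hn
  have hK := completeBipartiteGraph_connected (δ := δ) (N := Fintype.card W - δ) (by omega)
    (by omega)
  have hle : ∀ C : {C : Set V // H.IsComponent C}, homCount G (H.induce C.1) ≤
      homCount (completeBipartiteGraph (Fin δ) (Fin (Fintype.card W - δ))) (H.induce C.1) :=
    fun C => (hκ C W G (hκn C) hG hdeg).1
  rw [homCount_eq_sum_components hG, homCount_eq_sum_components hK]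
  refine ⟨sum_le_sum fun C _ => hle C, ?_⟩
  rintro ⟨C, hC, hedge, hloop, hbip⟩
  constructor
  · intro h
    exact (hκ ⟨C, hC⟩ W G (hκn _) hG hdeg).2 hedge hloop hbip
      ((sum_eq_sum_iff_of_le fun C _ => hle C).1 h ⟨C, hC⟩ (mem_univ _))
  · rintro ⟨e⟩
    exact sum_congr rfl fun C _ => homCount_congr e _
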